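/- Work in Quine's New Foundations (NF): extensionality together with the comprehension scheme $\forall \vec x\,\exists y\,\forall z\,(z\in y\leftrightarrow\varphi(\vec x,z))$ for all stratifiable formulas $\varphi$. Fix an ordered pair $\langle x,y\rangle$ whose two components receive the same type in a stratification. Write $\iota(y)=\{y\}$. A set $x$ is \emph{strongly cantorian} if $\iota\restriction x=\{\langle y,\{y\}\rangle : y\in x\}$ is a set. Let $\mathbf N$ be the category whose objects are the sets of NF and whose morphisms $A\to B$ are the functions from $A$ to $B$ whose graph is a set. Call a morphism $f:A\to B$ of $\mathbf N$ a \emph{strongly cantorian map} if for every $b\in B$ the fibre $\{a\in A : f(a)=b\}$ is strongly cantorian. Let SCU be the axiom that the sumset $\bigcup X$ of a strongly cantorian set $X$, all of whose elements are strongly cantorian, is strongly cantorian. \textbf{Theorem.} In NF + SCU (that is, in every model of NF + SCU), the strongly cantorian maps form a system of small maps on $\mathbf N$. This means: (i) they form a subcategory of $\mathbf N$ containing all objects of $\mathbf N$ (all identities are strongly cantorian maps, and so are composites of strongly cantorian maps); (ii) the pullback of a strongly cantorian map along any morphism is a strongly cantorian map; (iii) every diagonal $\Delta: C\to C\times C$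 is a strongly cantorian map; (iv) if $f\circ e$ is a strongly cantorian map and $e$ is a regular epimorphism, then $f$ is a strongly cantorian map; (v) if $f:A\to C$ and $g:B\to C$ are strongly cantorian maps, then so is the copair $[f,g]:A\sqcup B\to C$. -/

import Mathlib

open CategoryTheory CategoryTheory.Limits

universe u

namespace NewFoundations

/-! ### The language of set theory and stratified formulas -/

/-- The only nonlogical symbol of the language of set theory: a binary relation symbol. -/
inductive SetRel : ℕ → Type
  | mem : SetRel 2

/-- The first-order language of set theory. -/
def LSet : FirstOrder.Language.{0, 0} := ⟨fun _ => Empty, SetRel⟩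

/-- The type that an assignment `σ` of natural numbers to the variables gives to a term
(every term of the language of set theory is a variable). -/
def termType {β : Type} (σ : β → ℕ) : LSet.Term β → ℕ
  | .var x => σ x
  | .func f _ => Empty.elim f

/-- `Stratifies σ φ`: the assignment `σ` of types to the variables in scope extends to all bound
variables of `φ`, each bound variable receiving one type, in such a way that the two sides of
every equation `x = y` have the same type and in every `x ∈ y` the type of `y` is one more than
the type of `x`. -/
def Stratifies {α : Type} : {n : ℕ} → (α ⊕ Fin n → ℕ) → LSet.BoundedFormula α n → Prop
  | _, _, .falsum => True
  | _, σ, .equal s t => termType σ s = termType σ t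
  | _, σ, .rel SetRel.mem ts => termType σ (ts 0) + 1 = termType σ (ts 1)
  | _, σ, .imp φ ψ => Stratifies σ φ ∧ Stratifies σ ψ
  | _, σ, .all φ =>
      ∃ k : ℕ, Stratifies (Sum.elim (fun a => σ (Sum.inl a))
        (Fin.snoc (α := fun _ => ℕ) (fun i => σ (Sum.inr i)) k)) φ

/-- A formula is stratifiable if it has a stratification. -/
def Stratifiable {α : Type} (φ : LSet.Formula α) : Prop :=
  ∃ σ : α ⊕ Fin 0 → ℕ, Stratifies σ φ

/-! ### Models of NF -/

/-- Membership in a structure for the language of set theory. -/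
def Mem {M : Type u} [LSet.Structure M] (x y : M) : Prop :=
  FirstOrder.Language.Structure.RelMap (L := LSet) SetRel.mem ![x, y]

infix:50 " ∈ₛ " => NewFoundations.Mem

/-- Models of Quine's New Foundations: extensionality, and comprehension for every stratifiable
formula `φ(z, x₁, …, xₙ)` with parameters `x₁, …, xₙ`. -/
class NF (M : Type u) [LSet.Structure M] : Prop where
  ext : ∀ x y : M, (∀ z, z ∈ₛ x ↔ z ∈ₛ y) → x = y
  comprehension : ∀ (n : ℕ) (φ : LSet.Formula (Fin (n + 1))), Stratifiable φ →
    ∀ x : Fin n → M, ∃ y : M, ∀ z : M,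
      z ∈ₛ y ↔ φ.Realize (Fin.cons (α := fun _ => M) z x)

/-! ### Some formulas, needed to see that the sets used below exist -/

section Formulas

variable {α : Type} {n : ℕ}

/-- The formula `x ∈ y`. -/
def memF (x y : α ⊕ Fin n) : LSet.BoundedFormula α n :=
  .rel (l := 2) SetRel.mem ![.var x, .var y]

/-- The formula `x = y`. -/
def eqF (x y : α ⊕ Fin n) : LSet.BoundedFormula α n := .equal (.var x) (.var y)

/-- A variable, seen in the scope of one more quantifier. -/
def up (x : α ⊕ Fin n) : α ⊕ Fin (n + 1) := Sum.map id Fin.castSucc x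

/-- The variable bound by the innermost quantifier. -/
def new : α ⊕ Fin (n + 1) := Sum.inr (Fin.last n)

/-- The formula `p = {a, b}`. -/
def isUPairF (p a b : α ⊕ Fin n) : LSet.BoundedFormula α n :=
  .all ((memF new (up p)).iff (eqF new (up a) ⊔ eqF new (up b)))

/-- The formula `p = {{a}, {a, b}}`. -/
def isPairF (p a b : α ⊕ Fin n) : LSet.BoundedFormula α n :=
  .all ((memF new (up p)).iff
    (isUPairF new (up a) (up a) ⊔ isUPairF new (up a) (up b)))

/-- Extend a type assignment by a type for the innermost bound variable. -/
def extendType (σ : α ⊕ Fin n → ℕ) (k : ℕ) : α ⊕ Fin (n + 1) → ℕ :=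
  Sum.elim (fun a => σ (Sum.inl a)) (Fin.snoc (α := fun _ => ℕ) (fun i => σ (Sum.inr i)) k)

@[simp] theorem extendType_up (σ : α ⊕ Fin n → ℕ) (k : ℕ) (x : α ⊕ Fin n) :
    extendType σ k (up x) = σ x := by
  cases x <;> simp [extendType, up]

@[simp] theorem extendType_new (σ : α ⊕ Fin n → ℕ) (k : ℕ) :
    extendType σ k new = k := by
  simp [extendType, new]

variable (σ : α ⊕ Fin n → ℕ)

@[simp] theorem stratifies_mem (x y : α ⊕ Fin n) :
    Stratifies σ (memF x y) ↔ σ x + 1 = σ y := Iff.rfl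

@[simp] theorem stratifies_eq (x y : α ⊕ Fin n) :
    Stratifies σ (eqF x y) ↔ σ x = σ y := Iff.rfl

@[simp] theorem stratifies_imp (φ ψ : LSet.BoundedFormula α n) :
    Stratifies σ (φ.imp ψ) ↔ Stratifies σ φ ∧ Stratifies σ ψ := Iff.rfl

@[simp] theorem stratifies_all (φ : LSet.BoundedFormula α (n + 1)) :
    Stratifies σ φ.all ↔ ∃ k, Stratifies (extendType σ k) φ := Iff.rfl

@[simp] theorem stratifies_not (φ : LSet.BoundedFormula α n) :
    Stratifies σ φ.not ↔ Stratifies σ φ :=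
  ⟨fun h => h.1, fun h => ⟨h, trivial⟩⟩

@[simp] theorem stratifies_sup (φ ψ : LSet.BoundedFormula α n) :
    Stratifies σ (φ ⊔ ψ) ↔ Stratifies σ φ ∧ Stratifies σ ψ := by
  change Stratifies σ (φ.not.imp ψ) ↔ _
  simp

@[simp] theorem stratifies_inf (φ ψ : LSet.BoundedFormula α n) :
    Stratifies σ (φ ⊓ ψ) ↔ Stratifies σ φ ∧ Stratifies σ ψ := by
  change Stratifies σ (φ.imp ψ.not).not ↔ _
  simp

@[simp] theorem stratifies_iff (φ ψ : LSet.BoundedFormula α n) :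
    Stratifies σ (φ.iff ψ) ↔ Stratifies σ φ ∧ Stratifies σ ψ := by
  change Stratifies σ (φ.imp ψ ⊓ ψ.imp φ) ↔ _
  simp only [stratifies_inf, stratifies_imp]
  tauto

@[simp] theorem stratifies_ex (φ : LSet.BoundedFormula α (n + 1)) :
    Stratifies σ φ.ex ↔ ∃ k, Stratifies (extendType σ k) φ := by
  change Stratifies σ φ.not.all.not ↔ _
  simp

theorem stratifies_isUPair (p a b : α ⊕ Fin n) (ha : σ a + 1 = σ p) (hb : σ b + 1 = σ p) :
    Stratifies σ (isUPairF p a b) := by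
  simp only [isUPairF, stratifies_all, stratifies_iff, stratifies_sup, stratifies_mem,
    stratifies_eq, extendType_up, extendType_new]
  exact ⟨σ a, ha, rfl, by omega⟩

theorem stratifies_isPair (p a b : α ⊕ Fin n) (ha : σ a + 2 = σ p) (hb : σ b + 2 = σ p) :
    Stratifies σ (isPairF p a b) := by
  simp only [isPairF, stratifies_all, stratifies_iff, stratifies_sup, stratifies_mem,
    extendType_up, extendType_new]
  refine ⟨σ a + 1, by omega, ?_, ?_⟩ <;> apply stratifies_isUPair <;> simp <;> omega

variable {M : Type u} [LSet.Structure M] (v : α → M) (xs : Fin n → M)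

@[simp] theorem elim_snoc_up (x : α ⊕ Fin n) (a : M) :
    Sum.elim v (Fin.snoc (α := fun _ => M) xs a) (up x) = Sum.elim v xs x := by
  cases x <;> simp [up]

@[simp] theorem elim_snoc_new (a : M) :
    Sum.elim v (Fin.snoc (α := fun _ => M) xs a) new = a := by
  simp [new]

@[simp] theorem realize_mem (x y : α ⊕ Fin n) :
    (memF x y).Realize v xs ↔ Sum.elim v xs x ∈ₛ Sum.elim v xs y := by
  simp only [memF, FirstOrder.Language.BoundedFormula.Realize, Mem]
  apply iff_of_eq
  congr 1
  funext i
  fin_cases i <;> rfl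

@[simp] theorem realize_eq (x y : α ⊕ Fin n) :
    (eqF x y).Realize v xs ↔ Sum.elim v xs x = Sum.elim v xs y := Iff.rfl

@[simp] theorem realize_isUPair (p a b : α ⊕ Fin n) :
    (isUPairF p a b).Realize v xs ↔
      ∀ w, w ∈ₛ Sum.elim v xs p ↔ w = Sum.elim v xs a ∨ w = Sum.elim v xs b := by
  simp [isUPairF]

@[simp] theorem realize_isPair (p a b : α ⊕ Fin n) :
    (isPairF p a b).Realize v xs ↔
      ∀ w, w ∈ₛ Sum.elim v xs p ↔
        (∀ t, t ∈ₛ w ↔ t = Sum.elim v xs a ∨ t = Sum.elim v xs a) ∨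
        (∀ t, t ∈ₛ w ↔ t = Sum.elim v xs a ∨ t = Sum.elim v xs b) := by
  simp [isPairF]

end Formulas

/-! ### Unordered and ordered pairs, unions -/

variable {M : Type u} [LSet.Structure M] [NF M]

theorem exists_upair (a b : M) : ∃ y : M, ∀ z, z ∈ₛ y ↔ z = a ∨ z = b := by
  obtain ⟨y, hy⟩ := NF.comprehension (M := M) 2
    (eqF (Sum.inl 0) (Sum.inl 1) ⊔ eqF (Sum.inl 0) (Sum.inl 2))
    ⟨fun _ => 0, by simp⟩ ![a, b]
  refine ⟨y, fun z => (hy z).trans ?_⟩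
  simp only [FirstOrder.Language.Formula.Realize, FirstOrder.Language.BoundedFormula.realize_sup,
    realize_eq]
  rfl

/-- The unordered pair `{a, b}`. -/
noncomputable def upair (a b : M) : M := (exists_upair a b).choose

theorem mem_upair {a b z : M} : z ∈ₛ upair a b ↔ z = a ∨ z = b :=
  (exists_upair a b).choose_spec z

/-- The singleton `ι(a) = {a}`. -/
noncomputable def singleton (a : M) : M := upair a a

/-- The ordered pair `⟨a, b⟩ = {{a}, {a, b}}`, in which `a` and `b` have the same type. -/
noncomputable def pair (a b : M) : M := upair (singleton a) (upair a b)

theorem mem_singleton {a z : M} : z ∈ₛ singleton a ↔ z = a := by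
  simp [singleton, mem_upair]

theorem eq_upair_iff {a b w : M} : w = upair a b ↔ ∀ z, z ∈ₛ w ↔ z = a ∨ z = b := by
  constructor
  · rintro rfl z
    exact mem_upair
  · intro h
    exact NF.ext _ _ fun z => (h z).trans mem_upair.symm

theorem eq_pair_iff {a b p : M} : p = pair a b ↔
    ∀ w, w ∈ₛ p ↔ (∀ t, t ∈ₛ w ↔ t = a ∨ t = a) ∨ (∀ t, t ∈ₛ w ↔ t = a ∨ t = b) := by
  rw [pair, eq_upair_iff]
  simp only [singleton, eq_upair_iff]

theorem upair_eq_upair {a b c d : M} (h : upair a b = upair c d) :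
    (a = c ∧ b = d) ∨ (a = d ∧ b = c) := by
  have h1 : ∀ z, (z = a ∨ z = b) ↔ (z = c ∨ z = d) := fun z => by
    rw [← mem_upair, ← mem_upair, h]
  have ha := (h1 a).1 (Or.inl rfl)
  have hb := (h1 b).1 (Or.inr rfl)
  have hc := (h1 c).2 (Or.inl rfl)
  have hd := (h1 d).2 (Or.inr rfl)
  grind

theorem pair_inj {a b c d : M} : pair a b = pair c d ↔ a = c ∧ b = d := by
  constructor
  · intro h
    rcases upair_eq_upair h with ⟨h1, h2⟩ | ⟨h1, h2⟩
    · have := upair_eq_upair h1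
      have := upair_eq_upair h2
      grind
    · have := upair_eq_upair h1
      have := upair_eq_upair h2
      grind
  · rintro ⟨rfl, rfl⟩
    rfl

theorem exists_sUnion (X : M) : ∃ y : M, ∀ z, z ∈ₛ y ↔ ∃ x, x ∈ₛ X ∧ z ∈ₛ x := by
  obtain ⟨y, hy⟩ := NF.comprehension (M := M) 1
    (FirstOrder.Language.BoundedFormula.ex
      (memF new (up (Sum.inl 1)) ⊓ memF (up (Sum.inl 0)) new))
    ⟨Sum.elim ![0, 2] (fun _ => 0), by
      simp only [stratifies_ex, stratifies_inf, stratifies_mem, extendType_up, extendType_new]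
      exact ⟨1, rfl, rfl⟩⟩ ![X]
  refine ⟨y, fun z => (hy z).trans ?_⟩
  simp only [FirstOrder.Language.Formula.Realize, FirstOrder.Language.BoundedFormula.realize_ex,
    FirstOrder.Language.BoundedFormula.realize_inf, realize_mem, elim_snoc_up, elim_snoc_new]
  rfl

/-- The sumset `⋃ X`. -/
noncomputable def sUnion (X : M) : M := (exists_sUnion X).choose

theorem mem_sUnion {X z : M} : z ∈ₛ sUnion X ↔ ∃ x, x ∈ₛ X ∧ z ∈ₛ x :=
  (exists_sUnion X).choose_spec z

/-! ### Strongly cantorian sets and the axiom SCU -/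

/-- A set `x` is strongly cantorian if the graph `{⟨y, {y}⟩ | y ∈ x}` of the restriction of the
singleton operation to `x` is a set. -/
def StronglyCantorian (x : M) : Prop :=
  ∃ G : M, ∀ p, p ∈ₛ G ↔ ∃ y, y ∈ₛ x ∧ p = pair y (singleton y)

variable (M) in
/-- The axiom SCU: the sumset of a strongly cantorian set of strongly cantorian sets is strongly
cantorian. -/
def SCU : Prop :=
  ∀ X : M, StronglyCantorian X → (∀ x, x ∈ₛ X → StronglyCantorian x) →
    StronglyCantorian (sUnion X)

/-! ### The category of NF sets -/

variable (M) in
/-- The objects of the category of NF sets: the elements of the model. -/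
structure NFSet where
  /-- The underlying element of the model. -/
  set : M

/-- The elements of an NF set. -/
def NFSet.Elem (A : NFSet M) : Type u := {x : M // x ∈ₛ A.set}

/-- A map of NF sets is a function whose graph is a set of the model. -/
@[ext] structure NFMap (A B : NFSet M) where
  /-- The underlying function on elements. -/
  toFun : A.Elem → B.Elem
  exists_graph : ∃ G : M, ∀ p, p ∈ₛ G ↔ ∃ a : A.Elem, p = pair a.1 (toFun a).1

theorem exists_graph_id (A : NFSet M) :
    ∃ G : M, ∀ p, p ∈ₛ G ↔ ∃ a : A.Elem, p = pair a.1 a.1 := by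
  obtain ⟨y, hy⟩ := NF.comprehension (M := M) 1
    (FirstOrder.Language.BoundedFormula.ex
      (memF new (up (Sum.inl 1)) ⊓ isPairF (up (Sum.inl 0)) new new))
    ⟨Sum.elim ![2, 1] (fun _ => 0), by
      simp only [stratifies_ex, stratifies_inf, stratifies_mem, extendType_up, extendType_new]
      exact ⟨0, rfl, stratifies_isPair _ _ _ _ (by simp) (by simp)⟩⟩ ![A.set]
  refine ⟨y, fun p => (hy p).trans ?_⟩
  simp only [FirstOrder.Language.Formula.Realize, FirstOrder.Language.BoundedFormula.realize_ex,
    FirstOrder.Language.BoundedFormula.realize_inf, realize_mem, realize_isPair, elim_snoc_up,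
    elim_snoc_new, ← eq_pair_iff]
  exact ⟨fun ⟨a, h1, h2⟩ => ⟨⟨a, h1⟩, h2⟩, fun ⟨a, h⟩ => ⟨a.1, a.2, h⟩⟩

theorem exists_graph_comp {A B C : NFSet M} (f : NFMap A B) (g : NFMap B C) :
    ∃ G : M, ∀ p, p ∈ₛ G ↔ ∃ a : A.Elem, p = pair a.1 (g.toFun (f.toFun a)).1 := by
  obtain ⟨F, hF⟩ := f.exists_graph
  obtain ⟨G, hG⟩ := g.exists_graph
  have key : ∃ y : M, ∀ p, p ∈ₛ y ↔ ∃ a b c q r, p = pair a c ∧ (q ∈ₛ F ∧ q = pair a b) ∧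
      (r ∈ₛ G ∧ r = pair b c) := by
    obtain ⟨y, hy⟩ := NF.comprehension (M := M) 2
      (FirstOrder.Language.BoundedFormula.ex <| FirstOrder.Language.BoundedFormula.ex <|
        FirstOrder.Language.BoundedFormula.ex <| FirstOrder.Language.BoundedFormula.ex <|
        FirstOrder.Language.BoundedFormula.ex <|
        isPairF (Sum.inl 0) (up (up (up (up new)))) (up (up new)) ⊓
          ((memF (up new) (Sum.inl 1) ⊓
            isPairF (up new) (up (up (up (up new)))) (up (up (up new)))) ⊓
          (memF new (Sum.inl 2) ⊓ isPairF new (up (up (up new))) (up (up new)))))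
      ⟨Sum.elim ![2, 3, 3] (fun _ => 0), by
        simp only [stratifies_ex, stratifies_inf, stratifies_mem]
        refine ⟨0, 0, 0, 2, 2, ?_, ⟨?_, ?_⟩, ?_, ?_⟩ <;>
          first
          | (apply stratifies_isPair <;> simp only [extendType_up, extendType_new] <;> rfl)
          | (simp only [extendType_up, extendType_new]; rfl)⟩ ![F, G]
    refine ⟨y, fun p => (hy p).trans ?_⟩
    simp only [FirstOrder.Language.Formula.Realize,
      FirstOrder.Language.BoundedFormula.realize_ex,
      FirstOrder.Language.BoundedFormula.realize_inf, realize_mem, realize_isPair, elim_snoc_up,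
      elim_snoc_new, ← eq_pair_iff]
    rfl
  obtain ⟨y, hy⟩ := key
  refine ⟨y, fun p => (hy p).trans ?_⟩
  constructor
  · rintro ⟨a, b, c, q, r, rfl, ⟨hq, rfl⟩, hr, rfl⟩
    obtain ⟨a', ha⟩ := (hF _).1 hq
    obtain ⟨b', hb⟩ := (hG _).1 hr
    rw [pair_inj] at ha hb
    obtain ⟨rfl, h1⟩ := ha
    obtain ⟨h2, rfl⟩ := hb
    obtain rfl : b' = f.toFun a' := Subtype.ext (h2.symm.trans h1)
    exact ⟨a', rfl⟩
  · rintro ⟨a, rfl⟩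
    exact ⟨_, _, _, _, _, rfl, ⟨(hF _).2 ⟨a, rfl⟩, rfl⟩, (hG _).2 ⟨f.toFun a, rfl⟩, rfl⟩

/-- The category of NF sets. -/
instance : Category.{u} (NFSet M) where
  Hom := NFMap
  id A := ⟨id, exists_graph_id A⟩
  comp f g := ⟨g.toFun ∘ f.toFun, exists_graph_comp f g⟩

theorem exists_fiber {A B : NFSet M} (f : A ⟶ B) (b : B.Elem) :
    ∃ y : M, ∀ z, z ∈ₛ y ↔ ∃ a : A.Elem, f.toFun a = b ∧ z = a.1 := by
  obtain ⟨F, hF⟩ := f.exists_graph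
  obtain ⟨y, hy⟩ := NF.comprehension (M := M) 2
    (FirstOrder.Language.BoundedFormula.ex
      (memF new (up (Sum.inl 1)) ⊓ isPairF new (up (Sum.inl 0)) (up (Sum.inl 2))))
    ⟨Sum.elim ![0, 3, 0] (fun _ => 0), by
      simp only [stratifies_ex, stratifies_inf, stratifies_mem, extendType_up, extendType_new]
      exact ⟨2, rfl, stratifies_isPair _ _ _ _ (by simp) (by simp)⟩⟩ ![F, b.1]
  refine ⟨y, fun z => (hy z).trans ?_⟩
  simp only [FirstOrder.Language.Formula.Realize, FirstOrder.Language.BoundedFormula.realize_ex,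
    FirstOrder.Language.BoundedFormula.realize_inf, realize_mem, realize_isPair, elim_snoc_up,
    elim_snoc_new, ← eq_pair_iff]
  constructor
  · rintro ⟨p, h1, h2⟩
    have h2' : p = pair z b.1 := h2
    obtain ⟨a, ha⟩ := (hF p).1 h1
    obtain ⟨h3, h4⟩ := pair_inj.1 (h2'.symm.trans ha)
    exact ⟨a, Subtype.ext h4.symm, h3⟩
  · rintro ⟨a, rfl, rfl⟩
    exact ⟨_, (hF _).2 ⟨a, rfl⟩, rfl⟩

/-- The fibre `{a ∈ A | f(a) = b}` of a map `f : A ⟶ B` over an element `b` of `B`. -/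
noncomputable def fiber {A B : NFSet M} (f : A ⟶ B) (b : B.Elem) : M :=
  (exists_fiber f b).choose

theorem mem_fiber {A B : NFSet M} {f : A ⟶ B} {b : B.Elem} {z : M} :
    z ∈ₛ fiber f b ↔ ∃ a : A.Elem, f.toFun a = b ∧ z = a.1 :=
  (exists_fiber f b).choose_spec z

variable (M) in
/-- The class of strongly cantorian maps: those with strongly cantorian fibres. -/
def stronglyCantorianMaps : MorphismProperty (NFSet M) :=
  fun _ B f => ∀ b : B.Elem, StronglyCantorian (fiber f b)

/-! ### Systems of small maps -/

/-- A system of small maps on a category `C`. -/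
structure IsSystemOfSmallMaps {C : Type*} [Category C] (S : MorphismProperty C) : Prop where
  /-- The small maps form a subcategory with the same objects as `C`. -/
  subcategory : S.IsMultiplicative
  /-- The pullback of a small map along any map is small. -/
  pullback : S.IsStableUnderBaseChange
  /-- Diagonals `X ⟶ X ⨯ X` are small, for any choice of the product. -/
  diagonal : ∀ ⦃X P : C⦄ (p q : P ⟶ X) (h : IsLimit (BinaryFan.mk p q)),
    S (h.lift (BinaryFan.mk (𝟙 X) (𝟙 X)))
  /-- If `e ≫ f` is small and `e` is a regular epimorphism, then `f` is small. -/
  descent : ∀ ⦃X Y Z : C⦄ (e : X ⟶ Y) (f : Y ⟶ Z), IsRegularEpi e → S (e ≫ f) → S f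
  /-- Copairs `[f, g] : X ⨿ Y ⟶ Z` of small maps are small, for any choice of the coproduct. -/
  copair : ∀ ⦃X Y Z Q : C⦄ (i : X ⟶ Q) (j : Y ⟶ Q) (h : IsColimit (BinaryCofan.mk i j))
    (f : X ⟶ Z) (g : Y ⟶ Z), S f → S g → S (h.desc (BinaryCofan.mk f g))

end NewFoundations

/-! A set `E` is strongly cantorian when `e ↦ {e}` is a set function on it. The graph of this
function lets a variable ranging over `E` be replaced by one of a different type, so some
unstratified definitions become instances of comprehension. Two uses of this carry the proof.

`StronglyCantorian.of_injective_rel` transports the property: if a set relation sends the elements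
of `D` injectively to nonempty parts of `E`, the graph of the singleton operation on `E` can be
pulled back to `D`. Subsets and images of strongly cantorian sets are therefore strongly cantorian.

`exists_graph_sections` makes `b ↦ f⁻¹(b)`, whose value lies one type too high, a set function on a
strongly cantorian set. Hence for composable `f`, `g` the fibres of `f` over the points of `g⁻¹(c)`
form a strongly cantorian set, whose sumset is the fibre of `f ≫ g` over `c`. Composition is the
only place where SCU is needed.

The other closure properties become elementwise: monic-like data is tested on maps out of
singletons, and surjectivity by pairs of maps that differ at a single point. -/

namespace NewFoundations

open FirstOrder.Language

/-! ### Formulas about membership of pairs -/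

section PairFormulas

variable {α : Type} {n : ℕ}

/-- The formula `⟨x, y⟩ ∈ F`. -/
def pairMemF (x y F : α ⊕ Fin n) : LSet.BoundedFormula α n :=
  BoundedFormula.ex (memF new (up F) ⊓ isPairF new (up x) (up y))

/-- The pair lies two types above its components, and a set of pairs one further, whence the 3. -/
theorem stratifies_pairMem (σ : α ⊕ Fin n → ℕ) (x y F : α ⊕ Fin n) (hxy : σ x = σ y)
    (hF : σ x + 3 = σ F) : Stratifies σ (pairMemF x y F) := by
  simp only [pairMemF, stratifies_ex, stratifies_inf, stratifies_mem, extendType_up,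
    extendType_new]
  refine ⟨σ x + 2, hF, stratifies_isPair _ _ _ _ ?_ ?_⟩ <;> simp [hxy]

variable {M : Type u} [LSet.Structure M] [NF M] (v : α → M) (xs : Fin n → M)

theorem realize_isPair_iff (p a b : α ⊕ Fin n) :
    (isPairF p a b).Realize v xs ↔
      Sum.elim v xs p = pair (Sum.elim v xs a) (Sum.elim v xs b) := by
  rw [realize_isPair, eq_pair_iff]

theorem realize_isSingleton_iff (p a : α ⊕ Fin n) :
    (isUPairF p a a).Realize v xs ↔ Sum.elim v xs p = singleton (Sum.elim v xs a) := by
  rw [realize_isUPair, singleton, eq_upair_iff]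

theorem realize_pairMem (x y F : α ⊕ Fin n) :
    (pairMemF x y F).Realize v xs ↔
      pair (Sum.elim v xs x) (Sum.elim v xs y) ∈ₛ Sum.elim v xs F := by
  simp only [pairMemF, BoundedFormula.realize_ex, BoundedFormula.realize_inf, realize_mem,
    realize_isPair_iff, elim_snoc_up, elim_snoc_new]
  exact ⟨fun ⟨_, h, e⟩ => e ▸ h, fun h => ⟨_, h, rfl⟩⟩

end PairFormulas

variable {M : Type u} [LSet.Structure M] [NF M]

/-! ### Existence of some sets -/

theorem exists_empty : ∃ y : M, ∀ z, ¬ z ∈ₛ y := by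
  obtain ⟨y, hy⟩ := NF.comprehension (M := M) 0 BoundedFormula.falsum ⟨fun _ => 0, trivial⟩ ![]
  exact ⟨y, fun z h => (hy z).1 h⟩

/-- The empty set differs from its singleton. This supplies a two-element codomain for the
separating maps. -/
theorem exists_ne : ∃ a b : M, a ≠ b := by
  obtain ⟨a, ha⟩ := exists_empty (M := M)
  exact ⟨a, singleton a, fun h => ha a ((congrArg (Mem a) h).mpr (mem_singleton.2 rfl))⟩

theorem singleton_inj {a b : M} : singleton a = singleton b ↔ a = b :=
  ⟨fun h => mem_singleton.1 (h ▸ mem_singleton.2 rfl), fun h => h ▸ rfl⟩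

/-- The converse of a relation is a set. -/
theorem exists_converse (F : M) : ∃ y : M, ∀ a b, pair a b ∈ₛ y ↔ pair b a ∈ₛ F := by
  obtain ⟨y, hy⟩ := NF.comprehension (M := M) 1
    (BoundedFormula.ex <| BoundedFormula.ex <|
      isPairF (Sum.inl 0) (up new) new ⊓ pairMemF new (up new) (Sum.inl 1))
    ⟨Sum.elim ![2, 3] (fun _ => 0), by
      simp only [stratifies_ex, stratifies_inf]
      exact ⟨0, 0, stratifies_isPair _ _ _ _ rfl rfl, stratifies_pairMem _ _ _ _ rfl rfl⟩⟩ ![F]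
  refine ⟨y, fun a b => (hy _).trans ?_⟩
  simp only [Formula.Realize, BoundedFormula.realize_ex, BoundedFormula.realize_inf,
    realize_isPair_iff, realize_pairMem, elim_snoc_up, elim_snoc_new]
  constructor
  · rintro ⟨c, d, h, hF⟩
    obtain ⟨rfl, rfl⟩ := pair_inj.1 h
    exact hF
  · exact fun h => ⟨a, b, rfl, h⟩

/-- The set of those elements that a relation `F` relates to some element of `E`. -/
theorem exists_preimage (E F : M) : ∃ y : M, ∀ d, d ∈ₛ y ↔ ∃ e, e ∈ₛ E ∧ pair d e ∈ₛ F := by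
  obtain ⟨y, hy⟩ := NF.comprehension (M := M) 2
    (BoundedFormula.ex <|
      memF new (Sum.inl 1) ⊓ pairMemF (Sum.inl 0) new (Sum.inl 2))
    ⟨Sum.elim ![0, 1, 3] (fun _ => 0), by
      simp only [stratifies_ex, stratifies_inf]
      exact ⟨0, rfl, stratifies_pairMem _ _ _ _ rfl rfl⟩⟩ ![E, F]
  refine ⟨y, fun d => (hy _).trans ?_⟩
  simp only [Formula.Realize, BoundedFormula.realize_ex, BoundedFormula.realize_inf, realize_mem,
    realize_pairMem, elim_snoc_new]
  rfl

/-- The function on `Y` with value `a` at `y₀` and `b` elsewhere has a graph. -/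
theorem exists_graph_update (Y y₀ a b : M) : ∃ y : M, ∀ p, p ∈ₛ y ↔
    ∃ x, x ∈ₛ Y ∧ ((x = y₀ ∧ p = pair x a) ∨ (¬ x = y₀ ∧ p = pair x b)) := by
  obtain ⟨y, hy⟩ := NF.comprehension (M := M) 4
    (BoundedFormula.ex <|
      memF new (Sum.inl 1) ⊓
        ((eqF new (Sum.inl 2) ⊓ isPairF (Sum.inl 0) new (Sum.inl 3)) ⊔
          ((eqF new (Sum.inl 2)).not ⊓ isPairF (Sum.inl 0) new (Sum.inl 4))))
    ⟨Sum.elim ![2, 1, 0, 0, 0] (fun _ => 0), by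
      simp only [stratifies_ex, stratifies_inf, stratifies_sup, stratifies_not]
      exact ⟨0, rfl, ⟨rfl, stratifies_isPair _ _ _ _ rfl rfl⟩,
        rfl, stratifies_isPair _ _ _ _ rfl rfl⟩⟩ ![Y, y₀, a, b]
  refine ⟨y, fun d => (hy _).trans ?_⟩
  simp only [Formula.Realize, BoundedFormula.realize_ex, BoundedFormula.realize_inf,
    BoundedFormula.realize_sup, BoundedFormula.realize_not, realize_mem, realize_eq,
    realize_isPair_iff, elim_snoc_new]
  rfl

/-- If `G` is the graph of the singleton operation on a set, then `b ↦ {z | ⟨z, b⟩ ∈ F}` has a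
graph on this set. -/
theorem exists_graph_sections (F G : M) : ∃ H : M, ∀ x b, pair x b ∈ₛ H ↔
    ∃ c, pair b (singleton c) ∈ₛ G ∧ ∀ z, z ∈ₛ x ↔ pair z c ∈ₛ F := by
  -- The bound `b` and `c` denote one element at types 1 and 0. The clauses `⟨b, u⟩ ∈ G` and `u =
  -- {c}` link them, so that `x`, one type above `c`, gets the same type as `b`.
  obtain ⟨H, hH⟩ := NF.comprehension (M := M) 2
    (BoundedFormula.ex <| BoundedFormula.ex <| BoundedFormula.ex <| BoundedFormula.ex <|
      isPairF (Sum.inl 0) (up (up (up new))) (up (up new)) ⊓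
      (pairMemF (up (up new)) (up new) (Sum.inl 2) ⊓
      (isUPairF (up new) new new ⊓
      BoundedFormula.all
        ((memF new (up (up (up (up new))))).iff (pairMemF new (up new) (Sum.inl 1))))))
    ⟨Sum.elim ![3, 3, 4] (fun _ => 0), by
      simp only [stratifies_ex, stratifies_inf, stratifies_all, stratifies_iff]
      exact ⟨1, 1, 1, 0, stratifies_isPair _ _ _ _ rfl rfl, stratifies_pairMem _ _ _ _ rfl rfl,
        stratifies_isUPair _ _ _ _ rfl rfl, 0, rfl, stratifies_pairMem _ _ _ _ rfl rfl⟩⟩ ![F, G]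
  refine ⟨H, fun x b => (hH _).trans ?_⟩
  simp only [Formula.Realize, BoundedFormula.realize_ex, BoundedFormula.realize_inf,
    BoundedFormula.realize_all, BoundedFormula.realize_iff, realize_mem, realize_pairMem,
    realize_isPair_iff, realize_isSingleton_iff, elim_snoc_up, elim_snoc_new]
  constructor
  · rintro ⟨x', b', u, c, h, hG, rfl, hx⟩
    obtain ⟨rfl, rfl⟩ := pair_inj.1 h
    exact ⟨c, hG, hx⟩
  · rintro ⟨c, hG, hx⟩
    exact ⟨x, b, _, c, rfl, hG, rfl, hx⟩

/-! ### Strongly cantorian sets -/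

/-- If a set relation assigns to the elements of `D` pairwise disjoint nonempty sets of elements
of a strongly cantorian set `E`, then `D` is strongly cantorian. -/
theorem StronglyCantorian.of_injective_rel {D E F : M} (hE : StronglyCantorian E)
    (total : ∀ d, d ∈ₛ D → ∃ e, e ∈ₛ E ∧ pair d e ∈ₛ F)
    (inj : ∀ d d' e, d ∈ₛ D → d' ∈ₛ D → e ∈ₛ E → pair d e ∈ₛ F → pair d' e ∈ₛ F → d = d') :
    StronglyCantorian D := by
  obtain ⟨G, hG⟩ := hE
  have hG' : ∀ a b, pair a b ∈ₛ G ↔ a ∈ₛ E ∧ b = singleton a := fun a b => by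
    rw [hG]
    constructor
    · rintro ⟨y, hy, h⟩
      obtain ⟨rfl, rfl⟩ := pair_inj.1 h
      exact ⟨hy, rfl⟩
    · rintro ⟨h, rfl⟩
      exact ⟨a, h, rfl⟩
  -- The graph consists of the pairs `⟨d, {d'}⟩` such that `d F e`, `⟨e, {e'}⟩ ∈ G` and `d' F e'`.
  -- Here `d`, `e` have type 1 and `d'`, `e'` type 0. As `D` and `F` are needed at both levels, each
  -- is supplied twice as a parameter.
  obtain ⟨y, hy⟩ := NF.comprehension (M := M) 5
    (BoundedFormula.ex <| BoundedFormula.ex <| BoundedFormula.ex <| BoundedFormula.ex <|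
      BoundedFormula.ex <| BoundedFormula.ex <|
      isPairF (Sum.inl 0) (up (up (up (up (up new))))) (up (up (up (up new)))) ⊓
      (memF (up (up (up (up (up new))))) (Sum.inl 1) ⊓
      (pairMemF (up (up (up (up (up new))))) (up (up (up new))) (Sum.inl 2) ⊓
      (pairMemF (up (up (up new))) (up (up new)) (Sum.inl 3) ⊓
      (isUPairF (up (up (up (up new)))) (up new) (up new) ⊓
      (isUPairF (up (up new)) new new ⊓
      (memF (up new) (Sum.inl 4) ⊓
      pairMemF (up new) new (Sum.inl 5))))))))
    ⟨Sum.elim ![3, 2, 4, 4, 1, 3] (fun _ => 0), by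
      simp only [stratifies_ex, stratifies_inf]
      exact ⟨1, 1, 1, 1, 0, 0, stratifies_isPair _ _ _ _ rfl rfl, rfl,
        stratifies_pairMem _ _ _ _ rfl rfl, stratifies_pairMem _ _ _ _ rfl rfl,
        stratifies_isUPair _ _ _ _ rfl rfl, stratifies_isUPair _ _ _ _ rfl rfl, rfl,
        stratifies_pairMem _ _ _ _ rfl rfl⟩⟩ ![D, F, G, D, F]
  refine ⟨y, fun p => (hy p).trans ?_⟩
  simp only [Formula.Realize, BoundedFormula.realize_ex, BoundedFormula.realize_inf, realize_mem,
    realize_pairMem, realize_isPair_iff, realize_isSingleton_iff, elim_snoc_up, elim_snoc_new]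
  constructor
  · rintro ⟨d, w, e, u, d', e', hp, hd, hde, hu, rfl, rfl, hd', hde'⟩
    -- `G` forces `e = e'`; then injectivity forces `d = d'`.
    obtain ⟨he, h⟩ := (hG' _ _).1 hu
    obtain rfl := singleton_inj.1 h
    obtain rfl := inj d d' _ hd hd' he hde hde'
    exact ⟨d, hd, hp⟩
  · rintro ⟨d, hd, hp⟩
    obtain ⟨e, he, hde⟩ := total d hd
    exact ⟨d, _, e, _, d, e, hp, hd, hde, (hG' _ _).2 ⟨he, rfl⟩, rfl, rfl, hd, hde⟩

/-- The identity relation on `D` is an injective relation into `E`. -/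
theorem StronglyCantorian.subset {D E : M} (hE : StronglyCantorian E)
    (h : ∀ d, d ∈ₛ D → d ∈ₛ E) : StronglyCantorian D := by
  obtain ⟨F, hF⟩ := exists_graph_id (⟨D⟩ : NFSet M)
  refine hE.of_injective_rel (F := F) (fun d hd => ⟨d, h d hd, (hF _).2 ⟨⟨d, hd⟩, rfl⟩⟩) ?_
  intro d d' e _ _ _ h1 h2
  obtain ⟨a, ha⟩ := (hF _).1 h1
  obtain ⟨b, hb⟩ := (hF _).1 h2
  have := pair_inj.1 ha
  have := pair_inj.1 hb
  grind

theorem stronglyCantorian_singleton (a : M) : StronglyCantorian (singleton a) :=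
  ⟨singleton (pair a (singleton a)), fun p => by simp [mem_singleton]⟩

theorem StronglyCantorian.of_subsingleton {D : M} (h : ∀ a b, a ∈ₛ D → b ∈ₛ D → a = b) :
    StronglyCantorian D := by
  by_cases hD : ∃ a, a ∈ₛ D
  · obtain ⟨a, ha⟩ := hD
    exact (stronglyCantorian_singleton a).subset fun d hd => mem_singleton.2 (h d a hd ha)
  -- An empty `D` lies in every singleton; `{D}` is an arbitrary choice.
  · exact (stronglyCantorian_singleton D).subset fun d hd => (hD ⟨d, hd⟩).elim

/-- The union of the two singleton graphs is the graph for the union, so SCU is not required. -/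
theorem StronglyCantorian.union {D E : M} (hD : StronglyCantorian D) (hE : StronglyCantorian E) :
    StronglyCantorian (sUnion (upair D E)) := by
  obtain ⟨G, hG⟩ := hD
  obtain ⟨H, hH⟩ := hE
  refine ⟨sUnion (upair G H), fun p => ?_⟩
  simp only [mem_sUnion, mem_upair, or_and_right, exists_or, exists_eq_left, hG, hH]

/-- The image of a strongly cantorian set under a functional relation, here given by the pairs
`⟨value, argument⟩`, is a strongly cantorian set. -/
theorem StronglyCantorian.exists_image {E F : M} (hE : StronglyCantorian E)
    (h : ∀ d d' e, e ∈ₛ E → pair d e ∈ₛ F → pair d' e ∈ₛ F → d = d') :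
    ∃ D : M, StronglyCantorian D ∧ ∀ d, d ∈ₛ D ↔ ∃ e, e ∈ₛ E ∧ pair d e ∈ₛ F := by
  obtain ⟨D, hD⟩ := exists_preimage E F
  exact ⟨D, hE.of_injective_rel (fun d => (hD d).1) fun d d' e _ _ => h d d' e, hD⟩

/-! ### Maps of NF sets -/

theorem val_mem_fiber {A B : NFSet M} {f : A ⟶ B} {b : B.Elem} {a : A.Elem} :
    a.1 ∈ₛ fiber f b ↔ f.toFun a = b := by
  rw [mem_fiber]
  exact ⟨fun ⟨_, h, e⟩ => Subtype.ext e ▸ h, fun h => ⟨a, h, rfl⟩⟩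

theorem exists_graph_pair_mem {A B : NFSet M} (f : A ⟶ B) :
    ∃ F : M, ∀ a b, pair a b ∈ₛ F ↔ ∃ x : A.Elem, x.1 = a ∧ (f.toFun x).1 = b := by
  obtain ⟨F, hF⟩ := f.exists_graph
  refine ⟨F, fun a b => (hF _).trans ?_⟩
  simp only [pair_inj, eq_comm]

/-- The image of a strongly cantorian set under a map is a strongly cantorian set. -/
theorem StronglyCantorian.exists_map {A B : NFSet M} (f : A ⟶ B) {E : M}
    (hE : StronglyCantorian E) :
    ∃ D : M, StronglyCantorian D ∧ ∀ a : A.Elem, a.1 ∈ₛ E → (f.toFun a).1 ∈ₛ D := by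
  obtain ⟨F, hF⟩ := exists_graph_pair_mem f
  obtain ⟨F', hF'⟩ := exists_converse F
  obtain ⟨D, hD, h⟩ := hE.exists_image (F := F') fun d d' e _ h1 h2 => by
    obtain ⟨x, hx, rfl⟩ := (hF _ _).1 ((hF' _ _).1 h1)
    obtain ⟨y, hy, rfl⟩ := (hF _ _).1 ((hF' _ _).1 h2)
    rw [Subtype.ext (hx.trans hy.symm)]
  exact ⟨D, hD, fun a ha => (h _).2 ⟨a.1, ha, (hF' _ _).2 ((hF _ _).2 ⟨a, rfl, rfl⟩)⟩⟩

/-! ### Points and separating maps: the elementwise meaning of categorical conditions -/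

/-- The map `{t} ⟶ A` with value `a`. -/
noncomputable def constMap (t : M) {A : NFSet M} (a : A.Elem) :
    (⟨singleton t⟩ : NFSet M) ⟶ A :=
  NFMap.mk (fun _ => a) ⟨singleton (pair t a.1), fun p => by
    rw [mem_singleton]
    refine ⟨fun h => ⟨⟨t, mem_singleton.2 rfl⟩, h⟩, ?_⟩
    rintro ⟨x, rfl⟩
    exact congrArg (pair · a.1) (mem_singleton.1 x.2)⟩

theorem constMap_inj {t : M} {A : NFSet M} {a b : A.Elem} :
    constMap t a = constMap t b ↔ a = b :=
  ⟨fun h => congrFun (congrArg NFMap.toFun h) ⟨t, mem_singleton.2 rfl⟩, fun h => h ▸ rfl⟩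

theorem constMap_comp (t : M) {A B : NFSet M} (a : A.Elem) (f : A ⟶ B) :
    constMap t a ≫ f = constMap t (f.toFun a) := rfl

/-- For every element there are two maps that differ exactly at this element. -/
theorem exists_separating_maps {B : NFSet M} (b₀ : B.Elem) :
    ∃ (Z : NFSet M) (u v : B ⟶ Z), u.toFun b₀ ≠ v.toFun b₀ ∧
      ∀ b, b ≠ b₀ → u.toFun b = v.toFun b := by
  classical
  obtain ⟨s, t, hst⟩ := exists_ne (M := M)
  let Z : NFSet M := ⟨upair s t⟩
  have key : ∀ c d : Z.Elem, ∃ u : B ⟶ Z, u.toFun = fun b => if b = b₀ then c else d := by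
    intro c d
    refine ⟨NFMap.mk (fun b => if b = b₀ then c else d) ?_, rfl⟩
    obtain ⟨G, hG⟩ := exists_graph_update B.set b₀.1 c.1 d.1
    refine ⟨G, fun p => (hG p).trans ?_⟩
    constructor
    · rintro ⟨x, hx, ⟨rfl, h⟩ | ⟨h1, h⟩⟩
      · exact ⟨b₀, by simpa using h⟩
      · have hb : (⟨x, hx⟩ : B.Elem) ≠ b₀ := fun e => h1 (congrArg Subtype.val e)
        exact ⟨⟨x, hx⟩, h.trans (congrArg (fun z : Z.Elem => pair x z.1) (if_neg hb).symm)⟩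
    · rintro ⟨b, h⟩
      refine ⟨b.1, b.2, ?_⟩
      by_cases hb : b = b₀
      · exact Or.inl ⟨congrArg Subtype.val hb,
          h.trans (congrArg (fun z : Z.Elem => pair b.1 z.1) (if_pos hb))⟩
      · exact Or.inr ⟨fun e => hb (Subtype.ext e),
          h.trans (congrArg (fun z : Z.Elem => pair b.1 z.1) (if_neg hb))⟩
  let c : Z.Elem := ⟨s, mem_upair.2 (Or.inl rfl)⟩
  let d : Z.Elem := ⟨t, mem_upair.2 (Or.inr rfl)⟩
  -- `u` is `s` at `b₀` and `t` elsewhere; `v` is constantly `t`.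
  obtain ⟨u, hu⟩ := key c d
  obtain ⟨v, hv⟩ := key d d
  refine ⟨Z, u, v, ?_, fun b hb => ?_⟩
  · simp only [hu, hv, if_true]
    exact fun h => hst (congrArg Subtype.val h)
  · simp only [hu, hv, if_neg hb]

/-- Two maps differing only at a missed value would agree after composition with `e`. -/
theorem surjective_of_epi {A B : NFSet M} (e : A ⟶ B) [Epi e] : Function.Surjective e.toFun := by
  intro b₀
  by_contra! hb
  obtain ⟨Z, u, v, hne, h⟩ := exists_separating_maps b₀
  have : u = v := (cancel_epi e).1 (NFMap.ext (funext fun a => h _ (hb a)))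
  exact hne (this ▸ rfl)

theorem jointly_surjective_of_isColimit {A B Q : NFSet M} {i : A ⟶ Q} {j : B ⟶ Q}
    (h : IsColimit (BinaryCofan.mk i j)) (q : Q.Elem) :
    (∃ a, i.toFun a = q) ∨ ∃ b, j.toFun b = q := by
  by_contra! hq
  obtain ⟨Z, u, v, hne, huv⟩ := exists_separating_maps q
  have : u = v := BinaryCofan.IsColimit.hom_ext h (NFMap.ext (funext fun a => huv _ (hq.1 a)))
    (NFMap.ext (funext fun b => huv _ (hq.2 b)))
  exact hne (this ▸ rfl)

/-- Elements are maps from a singleton, and such maps into a pullback are determined by their two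
projections. The singleton `{x}` is just a convenient one. -/
theorem eq_of_isPullback {P A B C : NFSet M} {p : P ⟶ A} {q : P ⟶ B} {f : A ⟶ C} {g : B ⟶ C}
    (h : IsPullback p q f g) {x y : P.Elem} (hp : p.toFun x = p.toFun y)
    (hq : q.toFun x = q.toFun y) : x = y :=
  (constMap_inj (t := x.1)).1 <| h.hom_ext (by rw [constMap_comp, constMap_comp, hp])
    (by rw [constMap_comp, constMap_comp, hq])

/-! ### Strongly cantorian maps -/

theorem stronglyCantorianMaps_of_injective {A B : NFSet M} (f : A ⟶ B)
    (hf : Function.Injective f.toFun) : stronglyCantorianMaps M f := by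
  refine fun b => .of_subsingleton fun x y hx hy => ?_
  obtain ⟨a, ha, rfl⟩ := mem_fiber.1 hx
  obtain ⟨a', ha', rfl⟩ := mem_fiber.1 hy
  rw [hf (ha.trans ha'.symm)]

theorem stronglyCantorianMaps_comp (hSCU : SCU M) {A B C : NFSet M} (f : A ⟶ B) (g : B ⟶ C)
    (hf : stronglyCantorianMaps M f) (hg : stronglyCantorianMaps M g) :
    stronglyCantorianMaps M (f ≫ g) := by
  intro c
  obtain ⟨G, hG⟩ := hg c
  obtain ⟨F, hF⟩ := exists_graph_pair_mem f
  obtain ⟨H, hH⟩ := exists_graph_sections F G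
  -- `H` relates each fibre `f⁻¹(b)` to its base point `b`, for `b` in `g⁻¹(c)`.
  have hH' : ∀ x b, pair x b ∈ₛ H ↔ ∃ b' : B.Elem, b'.1 = b ∧ g.toFun b' = c ∧
      x = fiber f b' := by
    intro x b
    have hsec : ∀ b' : B.Elem, (∀ z, z ∈ₛ x ↔ pair z b'.1 ∈ₛ F) ↔ x = fiber f b' := by
      intro b'
      have h1 : ∀ z, pair z b'.1 ∈ₛ F ↔ z ∈ₛ fiber f b' := fun z => by
        rw [hF, mem_fiber]
        exact ⟨fun ⟨a, h, e⟩ => ⟨a, Subtype.ext e, h.symm⟩,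
          fun ⟨a, e, h⟩ => ⟨a, h.symm, congrArg _ e⟩⟩
      simp only [h1]
      exact ⟨NF.ext _ _, fun h => h ▸ fun _ => Iff.rfl⟩
    rw [hH]
    constructor
    · rintro ⟨d, hd, hx⟩
      obtain ⟨y, hy, e⟩ := (hG _).1 hd
      obtain ⟨rfl, e⟩ := pair_inj.1 e
      obtain rfl := singleton_inj.1 e
      obtain ⟨b', hb', rfl⟩ := mem_fiber.1 hy
      exact ⟨b', rfl, hb', (hsec b').1 hx⟩
    · rintro ⟨b', rfl, hb', hx⟩
      exact ⟨b'.1, (hG _).2 ⟨_, val_mem_fiber.2 hb', rfl⟩, (hsec b').2 hx⟩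
  -- `X` is the set of these fibres, the image of `g⁻¹(c)`. SCU applies to it, and the fibre of the
  -- composite is contained in `⋃ X`.
  obtain ⟨X, hX, hXmem⟩ := (hg c).exists_image (F := H) fun d d' e _ h1 h2 => by
    obtain ⟨b, hb, -, rfl⟩ := (hH' _ _).1 h1
    obtain ⟨b', hb', -, rfl⟩ := (hH' _ _).1 h2
    rw [Subtype.ext (hb.trans hb'.symm)]
  refine (hSCU X hX fun x hx => ?_).subset fun z hz => ?_
  · obtain ⟨_, -, h⟩ := (hXmem x).1 hx
    obtain ⟨b, -, -, rfl⟩ := (hH' _ _).1 h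
    exact hf b
  · obtain ⟨a, ha, rfl⟩ := mem_fiber.1 hz
    exact mem_sUnion.2 ⟨fiber f (f.toFun a), (hXmem _).2 ⟨(f.toFun a).1, val_mem_fiber.2 ha,
      (hH' _ _).2 ⟨_, rfl, ha, rfl⟩⟩, val_mem_fiber.2 rfl⟩

/-- The projection `p` embeds the fibre of `q` over `b` into the fibre of `f` over `g(b)`. -/
theorem stronglyCantorianMaps_of_isPullback {P A B C : NFSet M} {p : P ⟶ A} {q : P ⟶ B}
    {f : A ⟶ C} {g : B ⟶ C} (h : IsPullback p q f g) (hf : stronglyCantorianMaps M f) :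
    stronglyCantorianMaps M q := by
  intro b
  obtain ⟨F, hF⟩ := exists_graph_pair_mem p
  refine (hf (g.toFun b)).of_injective_rel (F := F) (fun d hd => ?_) ?_
  · obtain ⟨x, rfl, rfl⟩ := mem_fiber.1 hd
    exact ⟨(p.toFun x).1, val_mem_fiber.2 (congrFun (congrArg NFMap.toFun h.w) x),
      (hF _ _).2 ⟨x, rfl, rfl⟩⟩
  · intro d d' e hd hd' _ h1 h2
    obtain ⟨x, rfl, hx⟩ := (hF _ _).1 h1
    obtain ⟨y, rfl, hy⟩ := (hF _ _).1 h2
    rw [eq_of_isPullback h (Subtype.ext (hx.trans hy.symm))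
      ((val_mem_fiber.1 hd).trans (val_mem_fiber.1 hd').symm)]

/-- Since `e` is surjective, each fibre of `f` is covered by the image under `e` of the
corresponding fibre of `e ≫ f`. -/
theorem stronglyCantorianMaps_of_epi_comp {A B C : NFSet M} (e : A ⟶ B) (f : B ⟶ C) [Epi e]
    (h : stronglyCantorianMaps M (e ≫ f)) : stronglyCantorianMaps M f := by
  intro c
  obtain ⟨D, hD, hmem⟩ := (h c).exists_map e
  refine hD.subset fun z hz => ?_
  obtain ⟨b, rfl, rfl⟩ := mem_fiber.1 hz
  obtain ⟨a, rfl⟩ := surjective_of_epi e b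
  exact hmem a (val_mem_fiber.2 rfl)

/-- Since `i` and `j` are jointly surjective, a fibre of `f` is covered by the images of the fibres
of `i ≫ f` and `j ≫ f`. -/
theorem stronglyCantorianMaps_of_isColimit {A B C Q : NFSet M} {i : A ⟶ Q} {j : B ⟶ Q}
    (h : IsColimit (BinaryCofan.mk i j)) (f : Q ⟶ C) (hi : stronglyCantorianMaps M (i ≫ f))
    (hj : stronglyCantorianMaps M (j ≫ f)) : stronglyCantorianMaps M f := by
  intro c
  obtain ⟨D, hD, hDmem⟩ := (hi c).exists_map i
  obtain ⟨E, hE, hEmem⟩ := (hj c).exists_map j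
  refine (hD.union hE).subset fun z hz => ?_
  obtain ⟨q, rfl, rfl⟩ := mem_fiber.1 hz
  rw [mem_sUnion]
  rcases jointly_surjective_of_isColimit h q with ⟨a, rfl⟩ | ⟨b, rfl⟩
  · exact ⟨D, mem_upair.2 (Or.inl rfl), hDmem a (val_mem_fiber.2 rfl)⟩
  · exact ⟨E, mem_upair.2 (Or.inr rfl), hEmem b (val_mem_fiber.2 rfl)⟩

end NewFoundations

/-- In every model of NF + SCU, the strongly cantorian maps form a system of small maps on the
category of NF sets. -/
theorem mainTheorem9 (M : Type u) [NewFoundations.LSet.Structure M] [NewFoundations.NF M]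
    (hSCU : NewFoundations.SCU M) :
    NewFoundations.IsSystemOfSmallMaps (NewFoundations.stronglyCantorianMaps M) := by
  open NewFoundations in
  refine ⟨{ id_mem := fun A => stronglyCantorianMaps_of_injective _ fun _ _ h => h
            comp_mem := fun f g hf hg => stronglyCantorianMaps_comp hSCU f g hf hg },
    ⟨fun sq hg => stronglyCantorianMaps_of_isPullback sq hg⟩, ?_, ?_, ?_⟩
  · intro X P p q h
    refine stronglyCantorianMaps_of_injective _ fun x y hxy => ?_
    -- The diagonal is split by the projection `p`, hence injective, so its fibres have at most one
    -- element.
    have hd : h.lift (BinaryFan.mk (𝟙 X) (𝟙 X)) ≫ p = 𝟙 X :=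
      h.fac (BinaryFan.mk (𝟙 X) (𝟙 X)) ⟨WalkingPair.left⟩
    have hd' := congrFun (congrArg NFMap.toFun hd)
    exact (hd' x).symm.trans ((congrArg p.toFun hxy).trans (hd' y))
  · intro X Y Z e f he hef
    have : Epi e := inferInstance
    exact stronglyCantorianMaps_of_epi_comp e f hef
  · intro X Y Z Q i j h f g hf hg
    refine stronglyCantorianMaps_of_isColimit h _ ?_ ?_
    · rwa [show i ≫ h.desc (BinaryCofan.mk f g) = f from
        h.fac (BinaryCofan.mk f g) ⟨WalkingPair.left⟩]
    · rwa [show j ≫ h.desc (BinaryCofan.mk f g) = g from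
        h.fac (BinaryCofan.mk f g) ⟨WalkingPair.right⟩]
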